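/- Work over $\mathbb{C}$. Let $X$ be a normal variety with a fixed canonical divisor $K_X$. For a projective birational morphism $f\colon Y\to X$ from a normal variety, let $K_Y$ be the canonical divisor on $Y$ with $f_*K_Y=K_X$; for a prime divisor $P$ on $Y$ let $c_X(P)=f(P)$ and let $v_P$ be the corresponding valuation of $\mathbb{C}(X)$. For a Weil divisor $D$ on $X$ put $$v_P^{\natural}(D)=\min\{v_P(\phi)\mid 0\neq\phi\in\mathcal{O}_X(-D)(U),\ U\subset X\text{ open},\ U\cap c_X(P)\neq\emptyset\},$$ and for an integer $m\ge 1$ put $K_{m,Y/X}=K_Y-\frac1m\sum_E v_E^{\natural}(mK_X)\,E$, where $E$ runs over the prime divisors on $Y$. For an $\mathbb{R}$-divisor $\Delta\ge 0$ on $X$ let $$\alpha(P,X,\Delta)=\sup_{U,B_U}\ \mathrm{coeff}_{P|_V}\bigl(K_Y|_V-(f|_V)^*(K_U+\Delta|_U+B_U)\bigr),\qquad V=f^{-1}(U),\quad K_U=K_X|_U,$$ where $U$ runs over the affine open subsets of $X$ with $U\cap c_X(P)\neq\emptyset$ and $B_U$ over the effective $\mathbb{R}$-divisors on $U$ such that $K_U+\Delta|_U+B_U$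 is $\mathbb{R}$-Cartier. The pair $\langle X,\Delta\rangle$ is called pseudo-lc if $\alpha(P,X,\Delta)\ge -1$ for all such $f\colon Y\to X$ and all prime divisors $P$ on $Y$. **Proposition.** Let $\Delta\ge 0$ be an $\mathbb{R}$-divisor on $X$, written as a finite sum $\Delta=\sum_i d_i\Delta_i$ with real numbers $d_i\ge 0$ and (not necessarily prime or effective) Weil divisors $\Delta_i$. If there is an integer $m\ge 1$ such that $$\mathrm{coeff}_P(K_{m,Y/X})-\sum_i d_i\, v_P^{\natural}(\Delta_i)\ \ge\ -1$$ for every projective birational morphism $f\colon Y\to X$ from a normal variety and every prime divisor $P$ on $Y$, then $\langle X,\Delta\rangle$ is pseudo-lc. In particular, if $\langle X,0\rangle$ is log canonical in the sense of de Fernex and Hacon, that is, $X$ is quasi-projective and there is an integer $m\ge1$ with $\mathrm{coeff}_P(K_{m,Y/X})\ge -1$ for all such $f$ and $P$, then $\langle X,0\rangle$ is pseudo-lc. -/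

import Mathlib

open AlgebraicGeometry CategoryTheory
open scoped KaehlerDifferential

noncomputable section

namespace PseudoLC

/-- A normal (algebraic) variety over `ℂ`: a normal integral separated scheme of finite type
over `Spec ℂ`. -/
structure NormalVariety where
  /-- the underlying scheme -/
  toScheme : Scheme.{0}
  /-- the structure morphism -/
  str : toScheme ⟶ Spec (CommRingCat.of ℂ)
  isIntegral : IsIntegral toScheme
  isSeparated : IsSeparated str
  locallyOfFiniteType : LocallyOfFiniteType str
  quasiCompact : QuasiCompact str
  /-- normality: every local ring is integrally closed in its field of fractions -/
  normal : ∀ x : toScheme, IsIntegrallyClosed (toScheme.presheaf.stalk x)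

namespace NormalVariety

attribute [instance] isIntegral isSeparated locallyOfFiniteType quasiCompact

instance (X : NormalVariety) : IsLocallyNoetherian X.toScheme :=
  LocallyOfFiniteType.isLocallyNoetherian X.str

/-- The field of rational functions `ℂ(X)`. -/
abbrev ratFun (X : NormalVariety) : Type := X.toScheme.functionField

/-- The inclusion of the constants `ℂ → ℂ(X)` given by the structure morphism. -/
def constants (X : NormalVariety) : ℂ →+* X.ratFun :=
  ((Scheme.ΓSpecIso (CommRingCat.of ℂ)).inv ≫ X.str.appTop ≫
    X.toScheme.presheaf.germ ⊤ (genericPoint X.toScheme) trivial).hom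

instance (X : NormalVariety) : Algebra ℂ X.ratFun := X.constants.toAlgebra

end NormalVariety

/-- A prime divisor on `X`, given by its generic point: a point of codimension one. The prime
divisor itself, as a subset of `X`, is the closure of this point. -/
def PrimeDivisor (X : NormalVariety) : Type := {x : X.toScheme // Order.coheight x = 1}

/-- Weil divisors on `X` with coefficients in `R`
(`R = ℤ`: Weil divisors, `R = ℝ`: `ℝ`-divisors). -/
abbrev WeilDivisor (X : NormalVariety) (R : Type) [Zero R] : Type := PrimeDivisor X →₀ R

/-- Weil divisors on the open subset `U ⊆ X` with coefficients in `R`. The prime divisors on `U`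
are the prime divisors on `X` whose generic point lies in `U`. -/
abbrev DivisorOn {X : NormalVariety} (U : X.toScheme.Opens) (R : Type) [Zero R] : Type :=
  {P : PrimeDivisor X // P.1 ∈ U} →₀ R

/-- The restriction `D|_U`. -/
def WeilDivisor.restrict {X : NormalVariety} {R : Type} [Zero R] (D : WeilDivisor X R)
    (U : X.toScheme.Opens) : DivisorOn U R :=
  Finsupp.subtypeDomain (fun P : PrimeDivisor X => P.1 ∈ U) D

/-- A formal sum with integral coefficients, viewed with real coefficients. -/
def toReal {ι : Type} (D : ι →₀ ℤ) : ι →₀ ℝ :=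
  D.mapRange (fun n : ℤ => (n : ℝ)) Int.cast_zero

/-- The sections over `U` of the sheaf `𝒪_X(D)`: the rational functions `φ` such that `φ = 0` or
`div(φ)|_U + D|_U ≥ 0`. -/
def sections {X : NormalVariety} (D : WeilDivisor X ℤ) (U : X.toScheme.Opens) :
    Set X.ratFun :=
  {φ | φ = 0 ∨ ∀ P : PrimeDivisor X, P.1 ∈ U → 0 ≤ X.toScheme.ord φ P.1 + D P}

/-- The nonzero rational function `φ` is a local equation at the point `x` of the divisor `C` on
`U`: one has `C = div(φ)` on an open neighbourhood of `x` in `U`. -/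
def IsLocalEquation {X : NormalVariety} {U : X.toScheme.Opens} (C : DivisorOn U ℤ)
    (φ : X.ratFun) (x : X.toScheme) : Prop :=
  φ ≠ 0 ∧ ∃ W : X.toScheme.Opens, x ∈ W ∧ W ≤ U ∧
    ∀ Q : {P : PrimeDivisor X // P.1 ∈ U}, Q.1.1 ∈ W → C Q = X.toScheme.ord φ Q.1.1

/-- A divisor on `U` is Cartier if it is locally principal. -/
def IsCartier {X : NormalVariety} {U : X.toScheme.Opens} (C : DivisorOn U ℤ) : Prop :=
  ∀ x ∈ U, ∃ φ : X.ratFun, IsLocalEquation C φ x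

/-- An `ℝ`-divisor on `U` is `ℝ`-Cartier if it is a finite `ℝ`-linear combination of Cartier
divisors on `U`. -/
def IsRCartier {X : NormalVariety} {U : X.toScheme.Opens} (D : DivisorOn U ℝ) : Prop :=
  ∃ (k : ℕ) (r : Fin k → ℝ) (C : Fin k → DivisorOn U ℤ),
    (∀ j, IsCartier (C j)) ∧ D = ∑ j, r j • toReal (C j)

/-! ### Projective birational morphisms -/

/-- The invertible sheaf `𝒪_Y(H)` of the Cartier divisor `H` on `Y` is ample relatively to
`f : Y ⟶ S` (`f` of finite type): for every affine open `U ⊆ S` the restriction of `𝒪_Y(H)` to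
`f⁻¹(U)` is ample, that is, every point `y` of `f⁻¹(U)` lies in an affine open subset `W` that is
the nonvanishing locus `{s ≠ 0}` of a section `s` over `f⁻¹(U)` of `𝒪_Y(nH)`, for some `n ≥ 1`.
Here `s` is a rational function `φ`, and its nonvanishing locus is the complement in `f⁻¹(U)` of
the support of the effective divisor `div(φ) + nH`. -/
def IsRelativelyAmple {Y : NormalVariety} {S : Scheme.{0}} (f : Y.toScheme ⟶ S)
    (H : WeilDivisor Y ℤ) : Prop :=
  IsCartier (H.restrict ⊤) ∧
  ∀ U : S.Opens, IsAffineOpen U → ∀ y ∈ f ⁻¹ᵁ U,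
    ∃ n : ℕ, 1 ≤ n ∧ ∃ φ ∈ sections (n • H) (f ⁻¹ᵁ U), φ ≠ 0 ∧
      ∃ W : Y.toScheme.Opens, IsAffineOpen W ∧ y ∈ W ∧
        ∀ z : Y.toScheme, z ∈ W ↔ z ∈ f ⁻¹ᵁ U ∧
          ∀ P : PrimeDivisor Y, P.1 ⤳ z → Y.toScheme.ord φ P.1 + (n • H) P = 0

/-- `X` is quasi-projective: it carries an ample invertible sheaf. -/
def IsQuasiProjective (X : NormalVariety) : Prop :=
  ∃ H : WeilDivisor X ℤ, IsRelativelyAmple X.str H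

/-- A (higher) birational model of `X`: a normal variety `Y` together with a projective birational
morphism `f : Y ⟶ X` of varieties over `ℂ`. Projective means: proper, and there is a relatively
ample invertible sheaf. Birational means: an isomorphism over a nonempty open subset of `X`. -/
structure Model (X : NormalVariety) where
  /-- the variety `Y` -/
  Y : NormalVariety
  /-- the morphism `f : Y ⟶ X` -/
  f : Y.toScheme ⟶ X.toScheme
  f_str : f ≫ X.str = Y.str
  isProper : IsProper f
  exists_ample : ∃ H : WeilDivisor Y ℤ, IsRelativelyAmple f H
  birational : ∃ U : X.toScheme.Opens, (U : Set X.toScheme).Nonempty ∧ IsIso (f ∣_ U)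

namespace Model

variable {X : NormalVariety} (M : Model X)

theorem map_genericPoint_specializes :
    M.f (genericPoint M.Y.toScheme) ⤳ genericPoint X.toScheme := by
  obtain ⟨U, ⟨x, hx⟩, hU⟩ := M.birational
  have hη : genericPoint X.toScheme ∈ U :=
    (genericPoint_spec X.toScheme).mem_open_set_iff U.isOpen |>.2 ⟨x, trivial, hx⟩
  obtain ⟨y, hy⟩ : ∃ y, M.f y = genericPoint X.toScheme := by
    obtain ⟨z, hz⟩ := (M.f ∣_ U).surjective ⟨_, hη⟩
    refine ⟨(M.f ⁻¹ᵁ U).ι z, ?_⟩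
    rw [← Scheme.Hom.comp_apply, ← morphismRestrict_ι, Scheme.Hom.comp_apply, hz]
    rfl
  rw [← hy]
  exact ((genericPoint_spec M.Y.toScheme).specializes trivial).map M.f.continuous

/-- The pullback of rational functions `f^* : ℂ(X) → ℂ(Y)`. -/
def pullbackFun : X.ratFun →+* M.Y.ratFun :=
  (X.toScheme.presheaf.stalkSpecializes M.map_genericPoint_specializes ≫
    M.f.stalkMap (genericPoint M.Y.toScheme)).hom

/-- The divisorial valuation `v_P` on `ℂ(X)` of a prime divisor `P` on `Y` (only to be used on
nonzero functions). -/
def val (P : PrimeDivisor M.Y) (φ : X.ratFun) : ℤ :=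
  M.Y.toScheme.ord (M.pullbackFun φ) P.1

/-- The image `c_X(P)` on `X` of a prime divisor `P` on `Y`. -/
def center (P : PrimeDivisor M.Y) : Set X.toScheme :=
  M.f '' closure {P.1}

open Classical in
/-- The pushforward `f_* D` of a Weil divisor `D` on `Y`: a prime divisor `P` is sent to `f(P)` if
this is a prime divisor, and to `0` otherwise. (As `f` is birational, `P → f(P)` has degree `1` in
the first case.) -/
def pushforward {R : Type} [AddCommMonoid R] (D : WeilDivisor M.Y R) : WeilDivisor X R :=
  D.sum fun P r =>
    if h : Order.coheight (M.f P.1) = 1 then Finsupp.single (⟨M.f P.1, h⟩ : PrimeDivisor X) r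
    else 0

end Model

/-! ### Canonical divisors -/

/-- The dimension of `X`, as the dimension of `Ω_{ℂ(X)/ℂ}` over `ℂ(X)`. -/
def dim (X : NormalVariety) : ℕ := Module.finrank X.ratFun (Ω[X.ratFun⁄ℂ])

/-- The rational top differential forms on `X`: `⋀ⁿ Ω_{ℂ(X)/ℂ}` with `n = dim X`. -/
abbrev TopForm (X : NormalVariety) : Type := ⋀[X.ratFun]^(dim X) (Ω[X.ratFun⁄ℂ])

/-- The rational top forms that are regular at the generic point of `P`: the image of
`⋀ⁿ Ω_{A/ℂ}` in `⋀ⁿ Ω_{ℂ(X)/ℂ}` where `A` is the local ring of `X` at `P`, that is,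
the `A`-submodule spanned by the forms `da₁ ∧ ⋯ ∧ daₙ` with `aᵢ ∈ A`. -/
def regularForms {X : NormalVariety} (P : PrimeDivisor X) :
    Submodule (algebraMap (X.toScheme.presheaf.stalk P.1) X.ratFun).range (TopForm X) :=
  Submodule.span _ (Set.range fun a : Fin (dim X) → X.toScheme.presheaf.stalk P.1 =>
    exteriorPower.ιMulti X.ratFun (dim X) fun i =>
      KaehlerDifferential.D ℂ X.ratFun
        (algebraMap (X.toScheme.presheaf.stalk P.1) X.ratFun (a i)))

/-- `K` is the divisor of the rational top form `ω`. At a prime divisor `P` the lattice of regular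
forms is free of rank one over the discrete valuation ring at `P`; writing `ω = h • η` with `η` a
generator, the coefficient of `P` in `div(ω)` is `ord_P(h)`. Equivalently, it is the integer `k`
such that, for all rational functions `g ≠ 0`, the form `g • ω` is regular at `P` if and only if
`ord_P(g) + k ≥ 0`. -/
def IsDivisorOfForm {X : NormalVariety} (ω : TopForm X) (K : WeilDivisor X ℤ) : Prop :=
  ∀ (P : PrimeDivisor X) (g : X.ratFun), g ≠ 0 →
    (g • ω ∈ regularForms P ↔ 0 ≤ X.toScheme.ord g P.1 + K P)

/-- `K` is a canonical divisor on `X`: the divisor of a nonzero rational top form. -/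
def IsCanonicalDivisor {X : NormalVariety} (K : WeilDivisor X ℤ) : Prop :=
  ∃ ω : TopForm X, ω ≠ 0 ∧ IsDivisorOfForm ω K

/-! ### Discrepancies and pseudo-lc pairs -/

/-- For an `ℝ`-Cartier divisor `D` on the open subset `U ⊆ X` and a prime divisor `P` on `Y` whose
image meets `U`, the real number `c` is the coefficient of `P|_V` in `f_V^* D`, where
`V = f⁻¹(U)`: writing `D = ∑ rⱼ Cⱼ` with Cartier divisors `Cⱼ` on `U` and taking a local equation
`φⱼ` of `Cⱼ` at the generic point of the image of `P`, one has `c = ∑ rⱼ v_P(φⱼ)`. -/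
def IsPullbackCoeff {X : NormalVariety} (M : Model X) (P : PrimeDivisor M.Y)
    {U : X.toScheme.Opens} (D : DivisorOn U ℝ) (c : ℝ) : Prop :=
  ∃ (k : ℕ) (r : Fin k → ℝ) (C : Fin k → DivisorOn U ℤ) (φ : Fin k → X.ratFun),
    (∀ j, IsCartier (C j)) ∧ D = ∑ j, r j • toReal (C j) ∧
    (∀ j, IsLocalEquation (C j) (φ j) (M.f P.1)) ∧
    c = ∑ j, r j * (M.val P (φ j) : ℝ)

/-- `a = α_{⟨X,Δ⟩}(P, U, B) = coeff_{P|_V} (K_V - f_V^*(K_U + Δ|_U + B))`,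
where `K_U + Δ|_U + B` is `ℝ`-Cartier. -/
def IsLocalDiscrepancy {X : NormalVariety} (KX : WeilDivisor X ℤ) (Δ : WeilDivisor X ℝ)
    (M : Model X) (KY : WeilDivisor M.Y ℤ) (P : PrimeDivisor M.Y)
    (U : X.toScheme.Opens) (B : DivisorOn U ℝ) (a : ℝ) : Prop :=
  ∃ c : ℝ, IsPullbackCoeff M P (toReal (KX.restrict U) + Δ.restrict U + B) c ∧ a = KY P - c

/-- The discrepancy `α(P, X, Δ)`, computed with the canonical divisors `KX` and `KY`
(where `f_* KY = KX`): the supremum of `α_{⟨X,Δ⟩}(P, U, B)` over all affine open `U ⊆ X` that meet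
`c_X(P)` and all effective `ℝ`-divisors `B` on `U` such that `K_U + Δ|_U + B` is `ℝ`-Cartier. -/
def discrepancy {X : NormalVariety} (KX : WeilDivisor X ℤ) (Δ : WeilDivisor X ℝ)
    (M : Model X) (KY : WeilDivisor M.Y ℤ) (P : PrimeDivisor M.Y) : EReal :=
  sSup {e : EReal | ∃ (U : X.toScheme.Opens) (B : DivisorOn U ℝ) (a : ℝ),
    IsAffineOpen U ∧ ((U : Set X.toScheme) ∩ M.center P).Nonempty ∧ 0 ≤ B ∧
    IsRCartier (toReal (KX.restrict U) + Δ.restrict U + B) ∧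
    IsLocalDiscrepancy KX Δ M KY P U B a ∧ e = (a : EReal)}

/-- The pair `⟨X, Δ⟩` is pseudo-lc: `α(P, X, Δ) ≥ -1` for every prime divisor `P` over `X`.
Here `KX` is a fixed canonical divisor on `X`, and `KY` is the canonical divisor on `Y` with
`f_* KY = KX`; the notion does not depend on the choice of `KX`. -/
def IsPseudoLC {X : NormalVariety} (KX : WeilDivisor X ℤ) (Δ : WeilDivisor X ℝ) : Prop :=
  ∀ (M : Model X) (KY : WeilDivisor M.Y ℤ), IsCanonicalDivisor KY → M.pushforward KY = KX →
    ∀ P : PrimeDivisor M.Y, (-1 : EReal) ≤ discrepancy KX Δ M KY P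

/-! ### The notions of de Fernex and Hacon -/

/-- `v_P^♮(D)`: the minimum of `v_P(φ)` over all (nonzero) sections `φ ∈ 𝒪_X(-D)(U)` over open
subsets `U ⊆ X` that meet `c_X(P)`. -/
def Model.valNat {X : NormalVariety} (M : Model X) (P : PrimeDivisor M.Y)
    (D : WeilDivisor X ℤ) : ℤ :=
  sInf {n : ℤ | ∃ (U : X.toScheme.Opens) (φ : X.ratFun),
    ((U : Set X.toScheme) ∩ M.center P).Nonempty ∧ φ ∈ sections (-D) U ∧ φ ≠ 0 ∧
    n = M.val P φ}

/-- The divisor `f^♮ D = ∑_E v_E^♮(D) E` on `Y`, given by its coefficients. -/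
def Model.pullbackNat {X : NormalVariety} (M : Model X) (D : WeilDivisor X ℤ) :
    PrimeDivisor M.Y → ℤ :=
  fun E => M.valNat E D

/-- The relative canonical divisor `K_{m,Y/X} = K_Y - (1/m) f^♮(m K_X)`, given by its
coefficients. -/
def relCanonical {X : NormalVariety} (KX : WeilDivisor X ℤ) (M : Model X)
    (KY : WeilDivisor M.Y ℤ) (m : ℕ) : PrimeDivisor M.Y → ℝ :=
  fun P => (KY P : ℝ) - (1 / (m : ℝ)) * (M.pullbackNat (m • KX) P : ℝ)

/-- `⟨X, 0⟩` is log canonical in the sense of de Fernex and Hacon. -/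
def IsLogCanonicalDFH {X : NormalVariety} (KX : WeilDivisor X ℤ) : Prop :=
  IsQuasiProjective X ∧ ∃ m : ℕ, 1 ≤ m ∧
    ∀ (M : Model X) (KY : WeilDivisor M.Y ℤ), IsCanonicalDivisor KY → M.pushforward KY = KX →
      ∀ P : PrimeDivisor M.Y, -1 ≤ relCanonical KX M KY m P

end PseudoLC

end

open AlgebraicGeometry CategoryTheory
open scoped KaehlerDifferential

noncomputable section

/-! The sections that compute `v_P^♮` also supply the boundary divisor that the discrepancy asks
for. Write `K_X + Δ = ∑ eⱼ Eⱼ` with `eⱼ ≥ 0`, the summands being `(1/m)(mK_X)` and the `dᵢ Δᵢ`. Near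
the generic point of `c_X(P)` pick a nonzero section `φⱼ` of `𝒪_X(-Eⱼ)` with `v_P(φⱼ) ≤ v_P^♮(Eⱼ)`.
On a common affine open `V` one has `div(φⱼ) ≥ Eⱼ`, so `B = ∑ eⱼ div(φⱼ) - (K_X + Δ)` is effective,
and `K_X + Δ + B` is a combination of principal divisors whose pullback has coefficient `∑ eⱼ
v_P(φⱼ)` at `P`. Hence `α(P, X, Δ) ≥ coeff_P(K_Y) - ∑ eⱼ v_P^♮(Eⱼ)`
(`sub_sum_valNat_le_discrepancy`), and the right side is the quantity assumed to be at least `-1`.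

Two facts support this: `div(φ)` has finite support (`finite_ord_ne_zero`), and every `𝒪_X(D)` has a
nonzero section over a nonempty affine open (`exists_ne_zero_mem_sections`), so that `φⱼ` exists. -/

/-- A nonempty set of integers contains an element that is at most its infimum (which is its
minimum if it is bounded below). -/
theorem Int.exists_mem_le_sInf {S : Set ℤ} (hS : S.Nonempty) : ∃ n ∈ S, n ≤ sInf S := by
  by_cases hb : BddBelow S
  · exact ⟨sInf S, Int.csInf_mem hS hb, le_rfl⟩
  · rw [not_bddBelow_iff] at hb
    obtain ⟨n, hn, h⟩ := hb (sInf S)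
    exact ⟨n, hn, h.le⟩

/-! ### Zeros and poles on integral Noetherian schemes -/

/-- A proper closed subset of an integral Noetherian scheme contains only finitely many points of codimension one. -/
theorem AlgebraicGeometry.Scheme.finite_coheight_eq_one_notMem {X : Scheme} [IsIntegral X]
    [IsNoetherian X] (U : X.Opens) (hU : (U : Set X).Nonempty) :
    {x : X | Order.coheight x = 1 ∧ x ∉ U}.Finite := by
  obtain ⟨S, hSf, hS, hSU⟩ :=
    TopologicalSpace.NoetherianSpace.exists_finite_set_closeds_irreducible
      (⟨(U : Set X)ᶜ, U.isOpen.isClosed_compl⟩ : TopologicalSpace.Closeds X)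
  have hgen : genericPoint X ∈ U :=
    (genericPoint_spec X).mem_open_set_iff U.isOpen |>.2 (by simpa using hU)
  have hle : ∀ t ∈ S, (t : Set X) ⊆ (U : Set X)ᶜ := fun t ht => by
    have : t ≤ sSup S := le_sSup ht
    rw [← hSU] at this
    exact this
  have hcover : (U : Set X)ᶜ ⊆ ⋃ t ∈ S, (t : Set X) := by
    have : ((⟨(U : Set X)ᶜ, U.isOpen.isClosed_compl⟩ : TopologicalSpace.Closeds X) : Set X)
        = ((sSup S : TopologicalSpace.Closeds X) : Set X) := congrArg _ hSU
    change (U : Set X)ᶜ = _ at this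
    rw [this, sSup_eq_iSup]
    have hfin : IsClosed (⋃ t ∈ S, (t : Set X)) := hSf.isClosed_biUnion fun t _ => t.isClosed
    have : (⨆ a ∈ S, a : TopologicalSpace.Closeds X) ≤ ⟨_, hfin⟩ :=
      iSup₂_le fun t ht x hx => Set.mem_iUnion₂.2 ⟨t, ht, hx⟩
    exact this
  classical
  -- The points in question are among the generic points of the finitely many irreducible closed
  -- sets `t ∈ S`; the `else` value is never used.
  refine (hSf.image fun t : TopologicalSpace.Closeds X => if h : IsIrreducible (t : Set X) then h.genericPoint
    else genericPoint X).subset ?_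
  rintro x ⟨hx, hxU⟩
  obtain ⟨t, ht, hxt⟩ := Set.mem_iUnion₂.1 (hcover hxU)
  refine ⟨t, ht, ?_⟩
  simp only [hS t ht, dif_pos]
  set z := (hS t ht).genericPoint with hz
  have hcl : closure {z} = (t : Set X) :=
    (hS t ht).isGenericPoint_genericPoint t.isClosed
  have hzx : z ⤳ x := by rw [specializes_iff_mem_closure, hcl]; exact hxt
  have hzU : z ∉ U := hle t ht (hcl ▸ subset_closure rfl)
  -- Otherwise `x < z < ⊤` in the specialization order, which forces coheight at least two.
  by_contra hne
  have h1 : x < z := lt_of_le_not_ge hzx fun h : x ⤳ z => hne (hzx.antisymm h).eq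
  have h2 : z < ⊤ := lt_of_le_not_ge le_top fun h : z ⤳ genericPoint X => hzU (h.mem_open U.isOpen hgen)
  have h3 := Order.coheight_add_one_le h1
  have h4 := Order.coheight_add_one_le h2
  rw [hx] at h3
  have h5 : (1 : ℕ∞) + 1 ≤ 1 := le_trans (by gcongr; exact le_trans (by simp) h4) h3
  norm_num at h5

/-- A nonzero rational function on an integral Noetherian scheme has only finitely many zeros and
poles. -/
theorem AlgebraicGeometry.Scheme.finite_ord_ne_zero {X : Scheme} [IsIntegral X] [IsNoetherian X]
    (φ : X.functionField) : {x : X | X.ord φ x ≠ 0}.Finite := by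
  rcases eq_or_ne φ 0 with rfl | hφ
  · simp
  obtain ⟨U, -, f, hne, rfl, hf⟩ := exists_isUnit_germ_eq X φ hφ
  refine (Scheme.finite_coheight_eq_one_notMem U ((Set.nonempty_coe_sort).1 hne)).subset
    fun x hx => ⟨?_, fun hxU => hx (Scheme.ord_of_isUnit hf hxU)⟩
  -- Away from codimension one, `ord` is zero by convention.
  by_contra h
  exact hx (Scheme.ord_eq_zero_of_coheight_neq_one h _)

theorem AlgebraicGeometry.Scheme.ord_one {X : Scheme} [IsIntegral X] [IsLocallyNoetherian X]
    (x : X) : X.ord 1 x = 0 := by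
  have := Scheme.ord_mul (X := X) (x := x) one_ne_zero one_ne_zero
  rw [mul_one] at this
  omega

/-- Regular functions have nonnegative order. -/
theorem AlgebraicGeometry.Scheme.ord_germToFunctionField_nonneg {X : Scheme} [IsIntegral X]
    [IsLocallyNoetherian X] {U : X.Opens} [Nonempty U] {x : X} (hx : x ∈ U) (a : Γ(X, U)) :
    0 ≤ X.ord (X.germToFunctionField U a) x := by
  rcases eq_or_ne a 0 with rfl | ha
  · simp
  have := Scheme.ord_le_smul hx ha 1
  rwa [Scheme.ord_one, Algebra.smul_def, mul_one] at this

/-- At a point of codimension one of an affine open subset, some regular function vanishes. -/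
theorem AlgebraicGeometry.Scheme.exists_ord_pos {X : Scheme} [IsIntegral X]
    [IsLocallyNoetherian X] {U : X.Opens} [Nonempty U] (hU : IsAffineOpen U) {x : X} (hxU : x ∈ U)
    (hx : Order.coheight x = 1) :
    ∃ a : Γ(X, U), a ≠ 0 ∧ 0 < X.ord (X.germToFunctionField U a) x := by
  have hdim : Ring.KrullDimLE 1 (X.presheaf.stalk x) := krullDimLE_of_coheight_le hx.le
  have hnf : ¬ IsField (X.presheaf.stalk x) := fun h => by
    have h1 := ringKrullDim_eq_zero_of_isField h
    rw [ringKrullDim_stalk_eq_coheight, hx] at h1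
    exact one_ne_zero (WithBot.coe_eq_zero.1 h1)
  -- A nonzero nonunit `s` of the local ring becomes the germ of a regular function `a` after
  -- clearing its denominator, a unit at `x`.
  obtain ⟨s, hs0, hs⟩ := Ring.exists_not_isUnit_of_not_isField hnf
  let : Algebra Γ(X, U) (X.presheaf.stalk x) := (X.presheaf.germ U x hxU).hom.toAlgebra
  have hloc : IsLocalization.AtPrime (X.presheaf.stalk x) (hU.primeIdealOf ⟨x, hxU⟩).asIdeal :=
    hU.isLocalization_stalk ⟨x, hxU⟩
  obtain ⟨⟨a, t⟩, hat⟩ := IsLocalization.surj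
    (hU.primeIdealOf ⟨x, hxU⟩).asIdeal.primeCompl s
  have ht : IsUnit (X.presheaf.germ U x hxU t.1) :=
    IsLocalization.map_units (X.presheaf.stalk x) t
  change s * X.presheaf.germ U x hxU t.1 = X.presheaf.germ U x hxU a at hat
  set g := X.presheaf.germ U x hxU a with hg
  have hg0 : g ≠ 0 := hat ▸ mul_ne_zero hs0 ht.ne_zero
  have hgu : ¬ IsUnit g := fun h => hs (isUnit_of_mul_isUnit_left (hat ▸ h))
  have ha : a ≠ 0 := by
    rintro rfl
    exact hg0 (by simp [hg])
  refine ⟨a, ha, lt_of_le_of_ne (Scheme.ord_germToFunctionField_nonneg hxU a) fun h0 => ?_⟩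
  have hφ : X.germToFunctionField U a ≠ 0 := by
    simpa [map_ne_zero_iff, Scheme.germToFunctionField_injective] using ha
  rw [eq_comm, Scheme.ord_eq_iff hx hφ, ← Scheme.algebraMap_germ_eq_germToFunctionField X hxU a]
    at h0
  change Ring.ordFrac (X.presheaf.stalk x) _ = _ at h0
  rw [Ring.ordFrac_eq_ord _ hg0] at h0
  have hgm := mem_nonZeroDivisors_of_ne_zero hg0
  obtain ⟨n, hn⟩ := ENat.ne_top_iff_exists.1 (Ring.ord_ne_top hgm)
  rw [Ring.ordMonoidWithZeroHom_eq_coe _ hgm hn.symm, WithZero.coe_inj,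
    Multiplicative.ofAdd.injective.eq_iff, Nat.cast_eq_zero] at h0
  -- Order zero means that the quotient of the local ring by `g` has length zero, so `g` would be a
  -- unit.
  rw [h0, eq_comm, Ring.ord, Nat.cast_zero, Module.length_eq_zero_iff,
    Submodule.Quotient.subsingleton_iff, Ideal.span_singleton_eq_top] at hn
  exact hgu hn

/-! ### Principal divisors and sections of `𝒪_X(D)` -/

namespace PseudoLC

variable {X : NormalVariety}

instance NormalVariety.isNoetherian : IsNoetherian X.toScheme where
  toCompactSpace := compactSpace_iff_quasiCompact (X.toScheme) |>.2 (by
    rw [← Limits.terminal.comp_from X.str]; infer_instance)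

/-- The principal divisor `div(φ)`, which is `0` for `φ = 0`. -/
def principalDivisor (φ : X.ratFun) : WeilDivisor X ℤ :=
  Finsupp.ofSupportFinite (fun P => X.toScheme.ord φ P.1)
    ((Scheme.finite_ord_ne_zero φ).preimage Subtype.val_injective.injOn)

theorem principalDivisor_apply (φ : X.ratFun) (P : PrimeDivisor X) :
    principalDivisor φ P = X.toScheme.ord φ P.1 := rfl

theorem isLocalEquation_principalDivisor {φ : X.ratFun} (hφ : φ ≠ 0) {U : X.toScheme.Opens}
    {x : X.toScheme} (hx : x ∈ U) : IsLocalEquation ((principalDivisor φ).restrict U) φ x :=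
  ⟨hφ, U, hx, le_rfl, fun _ _ => rfl⟩

theorem isCartier_principalDivisor {φ : X.ratFun} (hφ : φ ≠ 0) (U : X.toScheme.Opens) :
    IsCartier ((principalDivisor φ).restrict U) :=
  fun _ hx => ⟨φ, isLocalEquation_principalDivisor hφ hx⟩

theorem sections_anti (D : WeilDivisor X ℤ) {U V : X.toScheme.Opens} (h : V ≤ U) :
    sections D U ⊆ sections D V :=
  fun _ hφ => hφ.imp_right fun hφ P hP => hφ P (h hP)

theorem mul_mem_sections {D E : WeilDivisor X ℤ} {U : X.toScheme.Opens} {φ ψ : X.ratFun}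
    (hφ : φ ∈ sections D U) (hψ : ψ ∈ sections E U) : φ * ψ ∈ sections (D + E) U := by
  rcases eq_or_ne φ 0 with rfl | hφ0
  · exact .inl (zero_mul _)
  rcases eq_or_ne ψ 0 with rfl | hψ0
  · exact .inl (mul_zero _)
  refine .inr fun P hP => ?_
  have h1 := hφ.resolve_left hφ0 P hP
  have h2 := hψ.resolve_left hψ0 P hP
  rw [Scheme.ord_mul hφ0 hψ0, Finsupp.add_apply]
  omega

/-- Over an affine open subset, the sheaf `𝒪_X(D)` of every Weil divisor `D` has a nonzero
section. -/
theorem exists_ne_zero_mem_sections (D : WeilDivisor X ℤ) {U : X.toScheme.Opens}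
    (hU : IsAffineOpen U) [Nonempty U] : ∃ φ ∈ sections D U, φ ≠ 0 := by
  induction D using Finsupp.induction_linear with
  | zero => exact ⟨1, .inr fun P _ => by simp [Scheme.ord_one], one_ne_zero⟩
  | add D E hD hE =>
    obtain ⟨φ, hφ, hφ0⟩ := hD
    obtain ⟨ψ, hψ, hψ0⟩ := hE
    exact ⟨φ * ψ, mul_mem_sections hφ hψ, mul_ne_zero hφ0 hψ0⟩
  | single Q n =>
    by_cases hQ : Q.1 ∈ U
    · obtain ⟨a, ha, hpos⟩ := Scheme.exists_ord_pos hU hQ Q.2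
      set ψ := X.toScheme.germToFunctionField U a with hψ
      have hψ0 : ψ ≠ 0 := by
        simpa [hψ, map_ne_zero_iff, Scheme.germToFunctionField_injective] using ha
      have hpow (k : ℕ) {P : X.toScheme} : X.toScheme.ord (ψ ^ k) P = k * X.toScheme.ord ψ P := by
        induction k with
        | zero => simp [Scheme.ord_one]
        | succ k ih =>
          rw [pow_succ, Scheme.ord_mul (pow_ne_zero _ hψ0) hψ0, ih]
          push_cast
          ring
      -- As `ψ` is regular on `U` with order at least `1` at `Q`, its power `|n|` has order at least
      -- `-n` at `Q` and nonnegative order elsewhere on `U`.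
      refine ⟨ψ ^ n.natAbs, .inr fun P hP => ?_, pow_ne_zero _ hψ0⟩
      rw [hpow]
      by_cases hPQ : Q = P
      · subst hPQ
        rw [Finsupp.single_eq_same]
        have : (n.natAbs : ℤ) * 1 ≤ n.natAbs * X.toScheme.ord ψ Q.1 := by gcongr; exact hpos
        omega
      · rw [Finsupp.single_eq_of_ne' hPQ, add_zero]
        exact mul_nonneg (by positivity) (Scheme.ord_germToFunctionField_nonneg hP a)
    · refine ⟨1, .inr fun P hP => ?_, one_ne_zero⟩
      rw [Finsupp.single_eq_of_ne (by rintro rfl; exact hQ hP), Scheme.ord_one, add_zero]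

namespace Model

variable (M : Model X)

theorem mem_center (P : PrimeDivisor M.Y) : M.f P.1 ∈ M.center P :=
  ⟨P.1, subset_closure rfl, rfl⟩

/-- An open subset meets the image of a prime divisor if and only if it contains its generic
point. -/
theorem mem_of_inter_center_nonempty {P : PrimeDivisor M.Y} {U : X.toScheme.Opens}
    (h : ((U : Set X.toScheme) ∩ M.center P).Nonempty) : M.f P.1 ∈ U := by
  obtain ⟨_, hy, y, hyP, rfl⟩ := h
  exact ((specializes_iff_mem_closure.2 hyP).map M.f.continuous).mem_open U.isOpen hy

/-- Only nonemptiness of the set defining `valNat` is needed, and sections over an affine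
neighbourhood provide it. Were the set unbounded below, `sInf` would take a default value, and some
element would still lie below it. -/
theorem exists_val_le_valNat (P : PrimeDivisor M.Y) (D : WeilDivisor X ℤ) :
    ∃ (U : X.toScheme.Opens) (φ : X.ratFun), M.f P.1 ∈ U ∧ φ ∈ sections (-D) U ∧ φ ≠ 0 ∧
      M.val P φ ≤ M.valNat P D := by
  obtain ⟨V, hV, hxV, -⟩ :=
    exists_isAffineOpen_mem_and_subset (TopologicalSpace.Opens.mem_top (M.f P.1))
  have : Nonempty V := ⟨⟨_, hxV⟩⟩
  obtain ⟨ψ, hψ, hψ0⟩ := exists_ne_zero_mem_sections (-D) hV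
  obtain ⟨_, ⟨U, φ, hU, hφ, hφ0, rfl⟩, hle⟩ := Int.exists_mem_le_sInf
    (S := {n : ℤ | ∃ (U : X.toScheme.Opens) (φ : X.ratFun),
      ((U : Set X.toScheme) ∩ M.center P).Nonempty ∧ φ ∈ sections (-D) U ∧ φ ≠ 0 ∧
      n = M.val P φ})
    ⟨_, V, ψ, ⟨_, hxV, M.mem_center P⟩, hψ, hψ0, rfl⟩
  exact ⟨U, φ, M.mem_of_inter_center_nonempty hU, hφ, hφ0, hle⟩

end Model

/-! ### The lower bound for the discrepancy -/

/-- If `K_X + Δ` is a combination of Weil divisors `Eⱼ` with coefficients `eⱼ ≥ 0`, then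
`α(P, X, Δ) ≥ coeff_P(K_Y) - ∑ eⱼ v_P^♮(Eⱼ)`. -/
theorem sub_sum_valNat_le_discrepancy {KX : WeilDivisor X ℤ} {Δ : WeilDivisor X ℝ} {k : ℕ}
    {e : Fin k → ℝ} (he : ∀ j, 0 ≤ e j) {E : Fin k → WeilDivisor X ℤ}
    (hE : toReal KX + Δ = ∑ j, e j • toReal (E j)) (M : Model X) (KY : WeilDivisor M.Y ℤ)
    (P : PrimeDivisor M.Y) :
    (((KY P : ℝ) - ∑ j, e j * (M.valNat P (E j) : ℝ) : ℝ) : EReal) ≤ discrepancy KX Δ M KY P := by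
  choose U φ hU hφ hφ0 hval using fun j => M.exists_val_le_valNat P (E j)
  obtain ⟨V, hV, hxV, hVU⟩ := exists_isAffineOpen_mem_and_subset
    (U := ⟨⋂ j, (U j : Set X.toScheme), isOpen_iInter_of_finite fun j => (U j).isOpen⟩)
    (Set.mem_iInter.2 hU)
  have hVU (j) : V ≤ U j := fun _ hx => Set.mem_iInter.1 (hVU hx) j
  set C : Fin k → DivisorOn V ℤ := fun j => (principalDivisor (φ j)).restrict V with hC
  -- This `B` turns `K_V + Δ|_V + B` into `∑ eⱼ div(φⱼ)|_V`.
  set B : DivisorOn V ℝ := ∑ j, e j • toReal (C j) - (toReal (KX.restrict V) + Δ.restrict V)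
    with hB
  have hsum : toReal (KX.restrict V) + Δ.restrict V + B = ∑ j, e j • toReal (C j) := by
    rw [hB]; abel
  have hCart (j) : IsCartier (C j) := isCartier_principalDivisor (hφ0 j) V
  have hB0 : 0 ≤ B := by
    intro Q
    have h1 : (KX Q.1 : ℝ) + Δ Q.1 = ∑ j, e j * (E j Q.1 : ℝ) := by
      simpa [toReal, Finsupp.finsetSum_apply] using DFunLike.congr_fun hE Q.1
    have h2 : B Q = ∑ j, e j * (X.toScheme.ord (φ j) Q.1.1 : ℝ) - ((KX Q.1 : ℝ) + Δ Q.1) := by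
      simp [hB, hC, toReal, WeilDivisor.restrict, principalDivisor_apply]
    rw [h2, h1, ← Finset.sum_sub_distrib]
    refine Finset.sum_nonneg fun j _ => ?_
    rw [← mul_sub]
    -- Effectivity is checked term by term: a section of `𝒪_X(-Eⱼ)` satisfies `div(φⱼ) ≥ Eⱼ` on `V`.
    have h3 := (sections_anti _ (hVU j) (hφ j)).resolve_left (hφ0 j) Q.1 Q.2
    rw [Finsupp.neg_apply] at h3
    refine mul_nonneg (he j) (sub_nonneg.2 ?_)
    exact_mod_cast (by omega : E j Q.1 ≤ X.toScheme.ord (φ j) Q.1.1)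
  -- The pair `(V, B)` contributes `coeff_P(K_Y) - ∑ eⱼ v_P(φⱼ)` to the supremum; the choice of `φⱼ`
  -- and `eⱼ ≥ 0` give the bound.
  refine le_trans (EReal.coe_le_coe_iff.2 ?_) (le_sSup ⟨V, B,
    KY P - ∑ j, e j * (M.val P (φ j) : ℝ), hV, ⟨_, hxV, M.mem_center P⟩, hB0,
    ⟨k, e, C, hCart, hsum⟩, ⟨_, ⟨k, e, C, φ, hCart, hsum,
      fun j => isLocalEquation_principalDivisor (hφ0 j) hxV, rfl⟩, rfl⟩, rfl⟩)
  gcongr with j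
  · exact he j
  · exact hval j

/-- The bound is applied to `K_X + Δ = (1/m)(mK_X) + ∑ dᵢ Dᵢ`; the index `0` carries the canonical
term, whose contribution is the one in `relCanonical`. -/
theorem isPseudoLC_of_le {KX : WeilDivisor X ℤ} {Δ : WeilDivisor X ℝ} {r : ℕ} {d : Fin r → ℝ}
    {D : Fin r → WeilDivisor X ℤ} (hd : ∀ i, 0 ≤ d i) (hΔ : Δ = ∑ i, d i • toReal (D i)) {m : ℕ}
    (hm : 1 ≤ m)
    (h : ∀ (M : Model X) (KY : WeilDivisor M.Y ℤ), IsCanonicalDivisor KY → M.pushforward KY = KX →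
      ∀ P : PrimeDivisor M.Y,
        -1 ≤ relCanonical KX M KY m P - ∑ i, d i * (M.valNat P (D i) : ℝ)) :
    IsPseudoLC KX Δ := by
  intro M KY hKY hpush P
  have hE : toReal KX + Δ = ∑ j : Fin (r + 1), (Fin.cons (1 / (m : ℝ)) d : Fin (r + 1) → ℝ) j •
      toReal ((Fin.cons (m • KX) D : Fin (r + 1) → WeilDivisor X ℤ) j) := by
    rw [Fin.sum_univ_succ]
    simp only [Fin.cons_zero, Fin.cons_succ, ← hΔ]
    congr 1
    ext Q
    have : (m : ℝ) ≠ 0 := by positivity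
    simp [toReal, this]
  refine le_trans ?_ (sub_sum_valNat_le_discrepancy (Fin.cases ?_ ?_) hE M KY P)
  · have := h M KY hKY hpush P
    rw [relCanonical, sub_sub] at this
    rw [Fin.sum_univ_succ]
    simp only [Fin.cons_zero, Fin.cons_succ]
    exact EReal.coe_le_coe_iff.2 this
  · simp only [Fin.cons_zero]
    positivity
  · simpa using hd

end PseudoLC

end

theorem proposition4p5 (X : PseudoLC.NormalVariety) (KX : PseudoLC.WeilDivisor X ℤ)
    (hKX : PseudoLC.IsCanonicalDivisor KX) :
    (∀ (r : ℕ) (d : Fin r → ℝ) (D : Fin r → PseudoLC.WeilDivisor X ℤ)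
      (Δ : PseudoLC.WeilDivisor X ℝ),
      (∀ i, 0 ≤ d i) → 0 ≤ Δ → Δ = ∑ i, d i • PseudoLC.toReal (D i) →
      (∃ m : ℕ, 1 ≤ m ∧
        ∀ (M : PseudoLC.Model X) (KY : PseudoLC.WeilDivisor M.Y ℤ),
          PseudoLC.IsCanonicalDivisor KY → M.pushforward KY = KX →
          ∀ P : PseudoLC.PrimeDivisor M.Y,
            -1 ≤ PseudoLC.relCanonical KX M KY m P - ∑ i, d i * (M.valNat P (D i) : ℝ)) →
      PseudoLC.IsPseudoLC KX Δ) ∧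
    (PseudoLC.IsLogCanonicalDFH KX → PseudoLC.IsPseudoLC KX 0) := by
  refine ⟨fun r d D Δ hd _ hΔ ⟨m, hm, h⟩ => PseudoLC.isPseudoLC_of_le hd hΔ hm h,
    fun ⟨_, m, hm, h⟩ => ?_⟩
  -- For `Δ = 0` the decomposition is the empty sum.
  refine PseudoLC.isPseudoLC_of_le (r := 0) (d := Fin.elim0) (D := Fin.elim0)
    (fun i => i.elim0) (by simp) hm fun M KY hKY hpush P => ?_
  simpa using h M KY hKY hpush P
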